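/- Let $\tau : SU(2) \to U(H)$ be a strongly continuous irreducible unitary representation of $SU(2)$ on a finite-dimensional complex Hilbert space $H$ with $\dim H = n+1$, $n \in \mathbb{N}_0$. The determinant of $\tau$ is the subspace $$\det(\tau,H) = \{ \xi \in H \otimes H \mid (\tau(g) \otimes \tau(g))\xi = \xi \ \text{ for all } g \in SU(2) \}$$ of $H \otimes H$. Let $f_0, f_1$ be the standard basis of $\mathbb{C}^2$, let $L_n = (\mathbb{C}^2)^{\otimes_S n} \subseteq (\mathbb{C}^2)^{\otimes n}$ be the Hilbert space of symmetric tensors (those fixed by all permutations of the tensor factors), and let $\rho_n : SU(2) \to U(L_n)$ be the restriction to $L_n$ of the $n$-fold tensor product of the fundamental representation of $SU(2)$ on $\mathbb{C}^2$. For $k \in \{0,1,\ldots,n\}$ put $$e_k = \sqrt{\frac{n!}{k!(n-k)!}} \; p_n\big( f_0^{\otimes k} \otimes f_1^{\otimes (n-k)} \big) \in L_n,$$ where $p_n$ is the orthogonal projection of $(\mathbb{C}^2)^{\otimes n}$ onto $L_n$. Then $\det(\tau,H)$ is one-dimensional. Moreover, for every unitary operator $V : L_n \to H$ with $V \rho_n(g)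 = \tau(g) V$ for all $g \in SU(2)$, the space $\det(\tau,H)$ is spanned by the vector $$(V \otimes V)\Big( (n+1)^{-1/2} \sum_{k=0}^n (-1)^{n-k} e_k \otimes e_{n-k} \Big).$$ -/

import Mathlib

open scoped TensorProduct

noncomputable section

namespace SUTwo

/-- The Lie group `SU(2)`, with the topology inherited from the `2 × 2` complex matrices. -/
abbrev SU2 : Type := Matrix.specialUnitaryGroup (Fin 2) ℂ

/-- The Hilbert space `ℂ²`. -/
abbrev C2 : Type := EuclideanSpace ℂ (Fin 2)

/-- The standard orthonormal basis `f₀, f₁` of `ℂ²`. -/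
def f (i : Fin 2) : C2 := EuclideanSpace.single i 1

/-! ### Unitary representations -/

section Rep

variable {H : Type*} [NormedAddCommGroup H] [InnerProductSpace ℂ H]

/-- The linear representation underlying a homomorphism from `SU(2)` into the group of unitary
operators `U(H)`, i.e. of surjective linear isometries of `H`. -/
def toRep (τ : SU2 →* (H ≃ₗᵢ[ℂ] H)) : Representation ℂ SU2 H where
  toFun g := (τ g).toLinearEquiv.toLinearMap
  map_one' := by ext x; simp
  map_mul' g h := by ext x; simp

/-- Strong continuity of a unitary representation. -/
def IsStronglyContinuous (τ : SU2 →* (H ≃ₗᵢ[ℂ] H)) : Prop :=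
  ∀ ξ : H, Continuous fun g : SU2 => τ g ξ

/-- Irreducibility: `H` is nonzero and has no invariant subspaces except `0` and `H`
(for finite-dimensional `H` all subspaces are closed). -/
def IsIrreducible (τ : SU2 →* (H ≃ₗᵢ[ℂ] H)) : Prop :=
  (toRep τ).IsIrreducible

/-- The determinant of `H` with respect to `τ`: the subspace of `H ⊗ H` of vectors fixed by
`τ g ⊗ τ g` for all `g` in `SU(2)`. -/
def determinant (τ : SU2 →* (H ≃ₗᵢ[ℂ] H)) : Submodule ℂ (H ⊗[ℂ] H) where
  carrier := {ξ | ∀ g : SU2, TensorProduct.map (toRep τ g) (toRep τ g) ξ = ξ}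
  add_mem' := fun {x y} hx hy g => by rw [map_add, hx g, hy g]
  zero_mem' := fun g => map_zero _
  smul_mem' := fun c x hx g => by rw [map_smul, hx g]

end Rep

/-! ### The Hilbert space `(ℂ²)^{⊗ n}` -/

/-- The `n`-fold tensor power `(ℂ²)^{⊗ n}`. A type synonym, since it carries the Hilbert space
norm. -/
def TensorPow (n : ℕ) : Type := ⨂[ℂ] _ : Fin n, C2

instance (n : ℕ) : AddCommGroup (TensorPow n) :=
  inferInstanceAs (AddCommGroup (⨂[ℂ] _ : Fin n, C2))

instance (n : ℕ) : Module ℂ (TensorPow n) :=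
  inferInstanceAs (Module ℂ (⨂[ℂ] _ : Fin n, C2))

/-- The elementary tensor `x₁ ⊗ ⋯ ⊗ xₙ`. -/
def elem {n : ℕ} (x : Fin n → C2) : TensorPow n := PiTensorProduct.tprod ℂ x

/-- The coordinates of a tensor in the basis `f_{i₁} ⊗ ⋯ ⊗ f_{iₙ}`. -/
def coords (n : ℕ) : TensorPow n ≃ₗ[ℂ] EuclideanSpace ℂ (Fin n → Fin 2) :=
  (Basis.piTensorProduct fun _ : Fin n => (EuclideanSpace.basisFun (Fin 2) ℂ).toBasis).equivFun ≪≫ₗ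
    (WithLp.linearEquiv 2 ℂ ((Fin n → Fin 2) → ℂ)).symm

theorem coords_elem {n : ℕ} (x : Fin n → C2) (p : Fin n → Fin 2) :
    coords n (elem x) p = ∏ i, x i (p i) := by
  change (Basis.piTensorProduct fun _ : Fin n =>
    (EuclideanSpace.basisFun (Fin 2) ℂ).toBasis).repr (PiTensorProduct.tprod ℂ x) p = _
  simp

instance (n : ℕ) : NormedAddCommGroup (TensorPow n) :=
  NormedAddCommGroup.induced _ _ (coords n).toLinearMap (coords n).injective

/-- The tensor product inner product; it is the one determined by `inner_elem` below. -/
instance (n : ℕ) : InnerProductSpace ℂ (TensorPow n) where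
  norm_smul_le c x := by
    change ‖coords n (c • x)‖ ≤ ‖c‖ * ‖coords n x‖
    rw [map_smul, norm_smul]
  inner x y := inner ℂ (coords n x) (coords n y)
  norm_sq_eq_re_inner x := by
    change ‖coords n x‖ ^ 2 = _
    exact norm_sq_eq_re_inner (𝕜 := ℂ) _
  conj_inner_symm x y := inner_conj_symm _ _
  add_left x y z := by rw [map_add, inner_add_left]
  smul_left x y c := by rw [map_smul, inner_smul_left]

instance (n : ℕ) : FiniteDimensional ℂ (TensorPow n) :=
  (coords n).symm.finiteDimensional

theorem inner_elem {n : ℕ} (x y : Fin n → C2) :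
    inner ℂ (elem x) (elem y) = ∏ i, inner ℂ (x i) (y i) := by
  change inner ℂ (coords n (elem x)) (coords n (elem y)) = _
  simp only [PiLp.inner_apply, coords_elem]
  rw [Finset.prod_univ_sum, Fintype.piFinset_univ]
  simp [map_prod, Finset.prod_mul_distrib]

theorem span_elem (n : ℕ) : Submodule.span ℂ (Set.range (elem (n := n))) = ⊤ :=
  PiTensorProduct.span_tprod_eq_top

/-! ### Symmetric tensors and the representations `ρₙ` -/

/-- The action of a permutation, `x₁ ⊗ ⋯ ⊗ xₙ ↦ x_{σ⁻¹(1)} ⊗ ⋯ ⊗ x_{σ⁻¹(n)}`. -/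
def permute {n : ℕ} (σ : Equiv.Perm (Fin n)) : TensorPow n →ₗ[ℂ] TensorPow n :=
  (PiTensorProduct.reindex ℂ (fun _ : Fin n => C2) σ).toLinearMap

theorem permute_elem {n : ℕ} (σ : Equiv.Perm (Fin n)) (x : Fin n → C2) :
    permute σ (elem x) = elem fun i => x (σ⁻¹ i) :=
  PiTensorProduct.reindex_tprod σ x

/-- The symmetric tensor power `Lₙ = (ℂ²)^{⊗_S n}`, a subspace of `(ℂ²)^{⊗ n}`. -/
def symmetricTensors (n : ℕ) : Submodule ℂ (TensorPow n) where
  carrier := {ξ | ∀ σ : Equiv.Perm (Fin n), permute σ ξ = ξ}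
  add_mem' := fun {x y} hx hy σ => by rw [map_add, hx σ, hy σ]
  zero_mem' := fun σ => map_zero _
  smul_mem' := fun c x hx σ => by rw [map_smul, hx σ]

/-- The Hilbert space `Lₙ`, with the inner product of `(ℂ²)^{⊗ n}`. -/
abbrev L (n : ℕ) : Type := symmetricTensors n

/-- The fundamental representation of `SU(2)` on `ℂ²`, as a map on vectors. -/
def fund (g : SU2) : C2 →ₗ[ℂ] C2 := Matrix.toEuclideanLin (g : Matrix (Fin 2) (Fin 2) ℂ)

theorem fund_one : fund 1 = LinearMap.id := by
  ext x; simp [fund]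

theorem fund_mul (g h : SU2) : fund (g * h) = fund g ∘ₗ fund h := by
  ext x : 1
  simp [fund, Matrix.toLpLin_apply]

theorem inner_fund (g : SU2) (x y : C2) : inner ℂ (fund g x) (fund g y) = inner ℂ x y := by
  have hg : star (g : Matrix (Fin 2) (Fin 2) ℂ) * g = 1 :=
    (Matrix.mem_unitaryGroup_iff').1 (Matrix.specialUnitaryGroup_le_unitaryGroup g.2)
  have : inner ℂ (fund g x) (fund g y)
      = inner ℂ x (Matrix.toEuclideanLin (star (g : Matrix (Fin 2) (Fin 2) ℂ)) (fund g y)) := by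
    rw [Matrix.star_eq_conjTranspose, Matrix.toEuclideanLin_conjTranspose_eq_adjoint,
      LinearMap.adjoint_inner_right]
    rfl
  rw [this]
  congr 1
  simp only [fund, Matrix.toLpLin_apply, Matrix.mulVec_mulVec, hg, Matrix.one_mulVec]

/-- The `n`-fold tensor product of the fundamental representation. -/
def tensorFund (n : ℕ) (g : SU2) : TensorPow n →ₗ[ℂ] TensorPow n :=
  PiTensorProduct.map (R := ℂ) (s := fun _ : Fin n => C2) (t := fun _ : Fin n => C2)
    fun _ => fund g

theorem tensorFund_elem {n : ℕ} (g : SU2) (x : Fin n → C2) :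
    tensorFund n g (elem x) = elem fun i => fund g (x i) :=
  PiTensorProduct.map_tprod _ _

theorem hom_ext {n : ℕ} {M : Type*} [AddCommGroup M] [Module ℂ M] {A B : TensorPow n →ₗ[ℂ] M}
    (h : ∀ x, A (elem x) = B (elem x)) : A = B :=
  LinearMap.ext_on_range (span_elem n) h

theorem tensorFund_one (n : ℕ) : tensorFund n 1 = LinearMap.id :=
  hom_ext fun x => by simp [tensorFund_elem, fund_one]

theorem tensorFund_mul (n : ℕ) (g h : SU2) :
    tensorFund n (g * h) = tensorFund n g ∘ₗ tensorFund n h :=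
  hom_ext fun x => by simp [tensorFund_elem, fund_mul]

theorem tensorFund_permute {n : ℕ} (g : SU2) (σ : Equiv.Perm (Fin n)) (ξ : TensorPow n) :
    permute σ (tensorFund n g ξ) = tensorFund n g (permute σ ξ) := by
  have : permute σ ∘ₗ tensorFund n g = tensorFund n g ∘ₗ permute σ :=
    hom_ext fun x => by simp [tensorFund_elem, permute_elem]
  exact LinearMap.congr_fun this ξ

theorem inner_tensorFund {n : ℕ} (g : SU2) (ξ η : TensorPow n) :
    inner ℂ (tensorFund n g ξ) (tensorFund n g η) = inner ℂ ξ η := by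
  have hξ : ξ ∈ Submodule.span ℂ (Set.range (elem (n := n))) := span_elem n ▸ Submodule.mem_top
  have hη : η ∈ Submodule.span ℂ (Set.range (elem (n := n))) := span_elem n ▸ Submodule.mem_top
  induction hξ using Submodule.span_induction with
  | zero => simp
  | add a b _ _ ha hb => simp [ha, hb]
  | smul c a _ ha => simp [ha]
  | mem a ha =>
    obtain ⟨x, rfl⟩ := ha
    induction hη using Submodule.span_induction with
    | zero => simp
    | add a b _ _ ha hb => simp [ha, hb]
    | smul c a _ ha => simp [ha]
    | mem b hb =>
      obtain ⟨y, rfl⟩ := hb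
      simp [tensorFund_elem, inner_elem, inner_fund]

theorem tensorFund_mem {n : ℕ} (g : SU2) {ξ : TensorPow n} (hξ : ξ ∈ symmetricTensors n) :
    tensorFund n g ξ ∈ symmetricTensors n := fun σ => by
  rw [tensorFund_permute, hξ σ]

/-- The restriction of the `n`-fold tensor product of the fundamental representation to `Lₙ`,
as a unitary operator. -/
def rhoOp (n : ℕ) (g : SU2) : L n ≃ₗᵢ[ℂ] L n :=
  LinearEquiv.isometryOfInner
    (LinearEquiv.ofLinearMap
      ((tensorFund n g).restrict fun _ h => tensorFund_mem g h)
      ((tensorFund n g⁻¹).restrict fun _ h => tensorFund_mem g⁻¹ h)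
      (by
        ext ξ
        have := LinearMap.congr_fun (tensorFund_mul n g g⁻¹) ξ
        simpa [tensorFund_one] using this.symm)
      (by
        ext ξ
        have := LinearMap.congr_fun (tensorFund_mul n g⁻¹ g) ξ
        simpa [tensorFund_one] using this.symm))
    (fun ξ η => inner_tensorFund g (ξ : TensorPow n) η)

theorem coe_rhoOp {n : ℕ} (g : SU2) (ξ : L n) :
    (rhoOp n g ξ : TensorPow n) = tensorFund n g ξ := rfl

/-- The unitary representation `ρₙ : SU(2) → U(Lₙ)`. -/
def rho (n : ℕ) : SU2 →* (L n ≃ₗᵢ[ℂ] L n) where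
  toFun := rhoOp n
  map_one' := by
    ext ξ
    simp [coe_rhoOp, tensorFund_one]
  map_mul' g h := by
    ext ξ
    simp [coe_rhoOp, tensorFund_mul]

/-! ### The vectors `e_k` and the invariant vector -/

/-- `f₀^k f₁^{n-k}`: the orthogonal projection onto `Lₙ` of `f₀^{⊗ k} ⊗ f₁^{⊗ (n-k)}`,
where `0 ≤ k ≤ n`. -/
def monomialVec (n k : ℕ) : L n :=
  (symmetricTensors n).orthogonalProjectionOnto
    (elem fun i : Fin n => if (i : ℕ) < k then f 0 else f 1)

/-- `e_k = √(n! / (k! (n-k)!)) · f₀^k f₁^{n-k}`, where `0 ≤ k ≤ n`. -/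
def e (n k : ℕ) : L n :=
  ((Real.sqrt ((n.factorial : ℝ) / (k.factorial * (n - k).factorial)) : ℝ) : ℂ) • monomialVec n k

/-- The vector `(n+1)^{-1/2} ∑_{k=0}^n (-1)^{n-k} e_k ⊗ e_{n-k}` in `Lₙ ⊗ Lₙ`. -/
def delta (n : ℕ) : L n ⊗[ℂ] L n :=
  (((Real.sqrt ((n : ℝ) + 1))⁻¹ : ℝ) : ℂ) •
    ∑ k ∈ Finset.range (n + 1), ((-1 : ℂ) ^ (n - k)) • (e n k ⊗ₜ[ℂ] e n (n - k))

/-- `V : Lₙ → H` is a unitary operator intertwining `ρₙ` and `τ`. -/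
def Intertwines {H : Type*} [NormedAddCommGroup H] [InnerProductSpace ℂ H] {n : ℕ}
    (V : L n ≃ₗᵢ[ℂ] H) (τ : SU2 →* (H ≃ₗᵢ[ℂ] H)) : Prop :=
  ∀ (g : SU2) (ξ : L n), V (rho n g ξ) = τ g (V ξ)

end SUTwo

end

/-!
The dimension of the space of invariants of a representation of a compact group is the integral of
its character `χ`. Every `g ∈ SU(2)` is conjugate to `g⁻¹`, so that `χ(g⁻¹) = χ(g)`, and the
invariants of `H ⊗ H` have dimension `∫ χ(g)² = ∫ χ(g⁻¹) χ(g) = dim End_{SU(2)} H`, which is `1` by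
Schur's lemma. On the other hand `f₀ ⊗ f₁ - f₁ ⊗ f₀` is invariant because `det g = 1`. Up to the
factor `(n+1)^{-1/2}`, the vector of `Lₙ ⊗ Lₙ` in the statement is the symmetrization of the `n`-th
tensor power of this one, hence it is invariant, and so is its image under `V ⊗ V`.
-/

noncomputable section

namespace SUTwo

section ContinuousRepresentations

open MeasureTheory Module

variable {𝕜 G V W : Type*} [Group G] [TopologicalSpace G]
  [AddCommGroup V] [AddCommGroup W]

/-- A representation whose matrix coefficients `g ↦ l (ρ g v)` are all continuous. This is strong
continuity in finite dimension, phrased so that it needs no topology on `V`. -/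
def HasContinuousCoeffs [Field 𝕜] [TopologicalSpace 𝕜] [Module 𝕜 V] (ρ : Representation 𝕜 G V) :
    Prop :=
  ∀ (l : Dual 𝕜 V) (v : V), Continuous fun g => l (ρ g v)

namespace HasContinuousCoeffs

variable [Field 𝕜] [TopologicalSpace 𝕜] [Module 𝕜 V] [Module 𝕜 W]
  {ρ : Representation 𝕜 G V} {σ : Representation 𝕜 G W}

theorem of_equiv (hρ : HasContinuousCoeffs ρ) (φ : ρ.Equiv σ) : HasContinuousCoeffs σ :=
  fun l w => (hρ (l ∘ₗ φ.toLinearEquiv.toLinearMap) (φ.symm w)).congr fun g => congrArg l <|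
    (Representation.IntertwiningMap.isIntertwining _ _ φ.toIntertwiningMap g (φ.symm w)).trans <|
      congrArg (σ g) (φ.apply_symm_apply w)

theorem dual [FiniteDimensional 𝕜 V] [ContinuousInv G] (hρ : HasContinuousCoeffs ρ) :
    HasContinuousCoeffs ρ.dual := fun l φ => by
  obtain ⟨v, rfl⟩ := (evalEquiv 𝕜 V).surjective l
  exact (hρ φ v).comp continuous_inv

theorem tprod [IsTopologicalSemiring 𝕜] [FiniteDimensional 𝕜 V] (hρ : HasContinuousCoeffs ρ)
    (hσ : HasContinuousCoeffs σ) : HasContinuousCoeffs (ρ.tprod σ) := fun l ξ => by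
  induction ξ with
  | zero => simpa only [map_zero] using continuous_const
  | add ξ η hξ hη => exact (hξ.add hη).congr fun g => by simp only [Pi.add_apply, map_add]
  | tmul v w =>
    let b := finBasis 𝕜 V
    have expand (g : G) : l (ρ.tprod σ g (v ⊗ₜ w)) =
        ∑ i, b.coord i (ρ g v) * (l ∘ₗ TensorProduct.mk 𝕜 V W (b i)) (σ g w) := by
      rw [Representation.tprod_apply, TensorProduct.map_tmul]
      conv_lhs => rw [← b.sum_repr (ρ g v)]
      simp [-Basis.sum_repr, TensorProduct.sum_tmul, ← TensorProduct.smul_tmul']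
    simp only [expand]
    exact continuous_finsetSum _ fun i _ => (hρ _ v).mul (hσ _ w)

theorem linHom [IsTopologicalSemiring 𝕜] [FiniteDimensional 𝕜 V] [FiniteDimensional 𝕜 W]
    [ContinuousInv G] (hρ : HasContinuousCoeffs ρ) (hσ : HasContinuousCoeffs σ) :
    HasContinuousCoeffs (ρ.linHom σ) :=
  (hρ.dual.tprod hσ).of_equiv (Representation.Equiv.dualTensorHom ρ σ)

end HasContinuousCoeffs

section Average

variable [RCLike 𝕜] [Module 𝕜 V] [MeasurableSpace G] [BorelSpace G] [CompactSpace G]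
  {ρ : Representation 𝕜 G V}

theorem HasContinuousCoeffs.integrable {μ : Measure G}
    [IsFiniteMeasure μ] (hρ : HasContinuousCoeffs ρ) (l : Dual 𝕜 V) (v : V) :
    Integrable (fun g => l (ρ g v)) μ :=
  (hρ l v).integrable_of_hasCompactSupport (HasCompactSupport.of_compactSpace _)

/-- The average `v ↦ ∫ g, ρ g v ∂μ` of a finite-dimensional representation. The integral is taken
weakly, through the identification of `V` with its bidual. -/
def weakAverage [FiniteDimensional 𝕜 V] (μ : Measure G) [IsFiniteMeasure μ]
    (hρ : HasContinuousCoeffs ρ) : V →ₗ[𝕜] V :=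
  (evalEquiv 𝕜 V).symm.toLinearMap ∘ₗ
    LinearMap.mk₂ 𝕜 (fun v l => ∫ g, l (ρ g v) ∂μ)
      (fun v w l => by
        simp only [map_add, integral_add (hρ.integrable l v) (hρ.integrable l w)])
      (fun c v l => by simp only [map_smul, integral_smul])
      (fun v l m => by
        simp only [LinearMap.add_apply, integral_add (hρ.integrable l v) (hρ.integrable m v)])
      (fun c v l => by simp only [LinearMap.smul_apply, integral_smul])

variable [FiniteDimensional 𝕜 V] {μ : Measure G}

theorem apply_weakAverage [IsFiniteMeasure μ] (hρ : HasContinuousCoeffs ρ) (l : Dual 𝕜 V) (v : V) :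
    l (weakAverage μ hρ v) = ∫ g, l (ρ g v) ∂μ :=
  apply_evalEquiv_symm_apply 𝕜 V l _

theorem isProj_weakAverage [ContinuousMul G] [IsProbabilityMeasure μ] [μ.IsMulLeftInvariant]
    (hρ : HasContinuousCoeffs ρ) : LinearMap.IsProj ρ.invariants (weakAverage μ hρ) where
  map_mem v h := eval_apply_injective 𝕜 <| LinearMap.ext fun l => calc
    l (ρ h (weakAverage μ hρ v)) = ∫ g, l (ρ h (ρ g v)) ∂μ := apply_weakAverage hρ (l ∘ₗ ρ h) v
    _ = ∫ g, l (ρ (h * g) v) ∂μ := by simp only [map_mul, Module.End.mul_apply]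
    _ = ∫ g, l (ρ g v) ∂μ := integral_mul_left_eq_self (fun g => l (ρ g v)) h
    _ = l (weakAverage μ hρ v) := (apply_weakAverage hρ l v).symm
  map_id v hv := eval_apply_injective 𝕜 <| LinearMap.ext fun l => by
    have hv' (g : G) : ρ g v = v := hv g
    simp [apply_weakAverage, hv']

theorem integral_character [ContinuousMul G] [IsProbabilityMeasure μ] [μ.IsMulLeftInvariant]
    (hρ : HasContinuousCoeffs ρ) : ∫ g, ρ.character g ∂μ = finrank 𝕜 ρ.invariants := by
  let b := finBasis 𝕜 V
  have trace_eq (A : V →ₗ[𝕜] V) : LinearMap.trace 𝕜 V A = ∑ i, b.coord i (A (b i)) := by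
    simp [LinearMap.trace_eq_matrix_trace 𝕜 b, Matrix.trace, LinearMap.toMatrix_apply]
  calc ∫ g, ρ.character g ∂μ = ∑ i, ∫ g, b.coord i (ρ g (b i)) ∂μ := by
        simp only [Representation.character, trace_eq]
        exact integral_finsetSum _ fun i _ => hρ.integrable _ _
    _ = LinearMap.trace 𝕜 V (weakAverage μ hρ) := by simp only [trace_eq, apply_weakAverage]
    _ = finrank 𝕜 ρ.invariants := (isProj_weakAverage hρ).trace

end Average

theorem finrank_invariants_tprod_self_of_isConj_inv [IsTopologicalGroup G] [CompactSpace G]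
    [Module ℂ V] [FiniteDimensional ℂ V] {ρ : Representation ℂ G V} [ρ.IsIrreducible]
    (hρ : HasContinuousCoeffs ρ) (hG : ∀ g : G, IsConj g g⁻¹) :
    finrank ℂ (ρ.tprod ρ).invariants = 1 := by
  borelize G
  let μ : Measure G := Measure.haarMeasure ⊤
  have : IsProbabilityMeasure μ := ⟨Measure.haarMeasure_self⟩
  have character_inv (g : G) : ρ.character g⁻¹ = ρ.character g := by
    obtain ⟨h, hh⟩ := isConj_iff.1 (hG g)
    rw [← hh, ρ.char_conj]
  have schur : finrank ℂ (ρ.linHom ρ).invariants = 1 := by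
    rw [(Representation.invariantsEquivIntertwiningMap ρ ρ).finrank_eq,
      Representation.IsIrreducible.finrank_intertwiningMap_self]
  suffices (finrank ℂ (ρ.tprod ρ).invariants : ℂ) = finrank ℂ (ρ.linHom ρ).invariants by
    rwa [schur, Nat.cast_inj] at this
  rw [← integral_character (μ := μ) (hρ.tprod hρ), ← integral_character (μ := μ) (hρ.linHom hρ)]
  simp only [Representation.char_tensor, Pi.mul_apply, Representation.char_linHom, character_inv]

end ContinuousRepresentations

section SpecialUnitary

open Matrix

variable {m 𝕜 : Type*} [Fintype m] [DecidableEq m] [RCLike 𝕜]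

theorem isCompact_unitaryGroup : IsCompact (unitaryGroup m 𝕜 : Set (Matrix m m 𝕜)) := by
  have box : IsCompact {A : Matrix m m 𝕜 | ∀ i j, A i j ∈ Metric.closedBall 0 1} := by
    have := isCompact_univ_pi fun _ : m => isCompact_univ_pi fun _ : m =>
      isCompact_closedBall (0 : 𝕜) 1
    simp only [Set.pi, Set.mem_univ, true_imp_iff] at this
    exact this
  refine box.of_isClosed_subset (isClosed_unitary) fun A hA i j => ?_
  simpa using entry_norm_bound_of_unitary hA i j

instance : CompactSpace (specialUnitaryGroup m 𝕜) := by
  refine isCompact_iff_compactSpace.1 ?_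
  have closed : IsClosed {A : Matrix m m 𝕜 | A.det = 1} :=
    isClosed_eq continuous_id.matrix_det continuous_const
  exact isCompact_unitaryGroup.inter_right closed

instance : IsTopologicalGroup (specialUnitaryGroup m 𝕜) where
  continuous_inv := (continuous_star.comp continuous_subtype_val).subtype_mk _

theorem star_eq_adjugate {A : Matrix m m 𝕜} (hA : A ∈ specialUnitaryGroup m 𝕜) :
    star A = A.adjugate := by
  obtain ⟨hU, hdet⟩ := mem_specialUnitaryGroup_iff.1 hA
  have : A.adjugate * A = 1 := by rw [adjugate_mul, hdet, one_smul]
  exact (left_inv_eq_right_inv this (mem_unitaryGroup_iff.1 hU)).symm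

end SpecialUnitary

section ConjugacyOfInverses

open Matrix ComplexConjugate

theorem exists_mul_conj_eq_neg (b : ℂ) :
    ∃ c : ℂ, conj c * c = 1 ∧ b * conj c = -(c * conj b) := by
  let u : ℂ := Complex.exp (b.arg * Complex.I)
  have hb : b = ‖b‖ * u := (Complex.norm_mul_exp_arg_mul_I b).symm
  have hu : conj u * u = 1 := by
    rw [Complex.conj_mul', Complex.norm_exp_ofReal_mul_I, Complex.ofReal_one, one_pow]
  refine ⟨Complex.I * u, ?_, ?_⟩
  · simp only [map_mul, Complex.conj_I]
    linear_combination hu - conj u * u * Complex.I_sq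
  · rw [hb]
    simp only [map_mul, Complex.conj_I, Complex.conj_ofReal]
    ring

theorem antidiagonal_mem_specialUnitaryGroup {c : ℂ} (hc : conj c * c = 1) :
    !![0, -conj c; c, 0] ∈ specialUnitaryGroup (Fin 2) ℂ := by
  have hc' : c * conj c = 1 := mul_comm _ c ▸ hc
  rw [mem_specialUnitaryGroup_iff, mem_unitaryGroup_iff, star_eq_conjTranspose]
  refine ⟨?_, by simp [det_fin_two, hc]⟩
  ext i j
  fin_cases i <;> fin_cases j <;> simp [mul_apply, hc, hc']

theorem eq_of_mem_specialUnitaryGroup {A : Matrix (Fin 2) (Fin 2) ℂ}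
    (hA : A ∈ specialUnitaryGroup (Fin 2) ℂ) :
    A = !![A 0 0, -conj (A 1 0); A 1 0, conj (A 0 0)] := by
  have h := star_eq_adjugate hA
  have h00 : conj (A 0 0) = A 1 1 := by simpa [adjugate_fin_two] using congrFun₂ h 0 0
  have h01 : conj (A 1 0) = -A 0 1 := by simpa [adjugate_fin_two] using congrFun₂ h 0 1
  rw [h00, h01, neg_neg]
  exact A.eta_fin_two

theorem isConj_inv (g : SU2) : IsConj g g⁻¹ := by
  obtain ⟨A, hA⟩ := g
  obtain ⟨c, hc, hcb⟩ := exists_mul_conj_eq_neg (A 1 0)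
  refine isConj_iff.2 ⟨⟨_, antidiagonal_mem_specialUnitaryGroup hc⟩,
    mul_inv_eq_iff_eq_mul.2 (Subtype.ext ?_)⟩
  change !![0, -conj c; c, 0] * A = star A * !![0, -conj c; c, 0]
  rw [star_eq_adjugate hA, eq_of_mem_specialUnitaryGroup hA, adjugate_fin_two_of]
  ext i j
  fin_cases i <;> fin_cases j <;> simp [hcb, mul_comm]

end ConjugacyOfInverses

section Determinant

variable {H : Type*} [NormedAddCommGroup H] [InnerProductSpace ℂ H]

theorem determinant_eq_invariants (τ : SU2 →* (H ≃ₗᵢ[ℂ] H)) :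
    determinant τ = ((toRep τ).tprod (toRep τ)).invariants :=
  rfl

theorem IsStronglyContinuous.hasContinuousCoeffs [FiniteDimensional ℂ H]
    {τ : SU2 →* (H ≃ₗᵢ[ℂ] H)} (hτ : IsStronglyContinuous τ) : HasContinuousCoeffs (toRep τ) :=
  fun l v => l.continuous_of_finiteDimensional.comp (hτ v)

theorem finrank_determinant [FiniteDimensional ℂ H] {τ : SU2 →* (H ≃ₗᵢ[ℂ] H)}
    (hcont : IsStronglyContinuous τ) (hirr : IsIrreducible τ) :
    Module.finrank ℂ (determinant τ) = 1 := by
  have : (toRep τ).IsIrreducible := hirr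
  rw [determinant_eq_invariants]
  exact finrank_invariants_tprod_self_of_isConj_inv hcont.hasContinuousCoeffs isConj_inv

theorem Intertwines.isIntertwiningMap {n : ℕ} {V : L n ≃ₗᵢ[ℂ] H} {τ : SU2 →* (H ≃ₗᵢ[ℂ] H)}
    (hV : Intertwines V τ) :
    (toRep (rho n)).IsIntertwiningMap (toRep τ) V.toLinearEquiv.toLinearMap :=
  ⟨hV⟩

end Determinant

theorem map_mem_invariants_tprod {R G M N : Type*} [CommRing R] [Group G] [AddCommGroup M]
    [Module R M] [AddCommGroup N] [Module R N] {ρ : Representation R G M}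
    {σ : Representation R G N} {A : M →ₗ[R] N} (hA : ρ.IsIntertwiningMap σ A) {ξ : M ⊗[R] M}
    (hξ : ξ ∈ (ρ.tprod ρ).invariants) :
    TensorProduct.map A A ξ ∈ (σ.tprod σ).invariants := fun g => by
  have comm : σ g ∘ₗ A = A ∘ₗ ρ g := LinearMap.ext fun v => (hA.isIntertwining g v).symm
  calc TensorProduct.map (σ g) (σ g) (TensorProduct.map A A ξ)
      = TensorProduct.map A A (TensorProduct.map (ρ g) (ρ g) ξ) := by
        simp only [TensorProduct.map_map, comm]
    _ = TensorProduct.map A A ξ := congrArg _ (hξ g)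

section WedgePower

variable {R ι M N : Type*} [CommRing R] [AddCommGroup M] [Module R M] [AddCommGroup N]
  [Module R N]

variable (R ι M N) in
/-- The regrouping map `M^{⊗ι} ⊗ N^{⊗ι} → (M ⊗ N)^{⊗ι}`. -/
def zipTensor : (⨂[R] _ : ι, M) ⊗[R] (⨂[R] _ : ι, N) →ₗ[R] ⨂[R] _ : ι, M ⊗[R] N :=
  TensorProduct.lift (PiTensorProduct.map₂ fun _ => TensorProduct.mk R M N)

@[simp]
theorem zipTensor_tprod_tmul_tprod (x : ι → M) (y : ι → N) :
    zipTensor R ι M N (PiTensorProduct.tprod R x ⊗ₜ PiTensorProduct.tprod R y) =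
      PiTensorProduct.tprod R fun i => x i ⊗ₜ[R] y i := by
  simp [zipTensor, PiTensorProduct.map₂_tprod_tprod]

theorem zipTensor_injective [Finite ι] [Module.Free R M] [Module.Free R N] :
    Function.Injective (zipTensor R ι M N) := by
  let b := Module.Free.chooseBasis R M
  let c := Module.Free.chooseBasis R N
  let B := (Basis.piTensorProduct fun _ : ι => b).tensorProduct
    (Basis.piTensorProduct fun _ : ι => c)
  let E := B.equiv (Basis.piTensorProduct fun _ : ι => b.tensorProduct c)
    (Equiv.arrowProdEquivProdArrow ι _ _).symm
  have zip_eq : zipTensor R ι M N = E.toLinearMap := B.ext fun p => by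
    rw [LinearEquiv.coe_coe, Module.Basis.equiv_apply]
    simp [B, Module.Basis.tensorProduct_apply', Basis.piTensorProduct_apply]
  rw [zip_eq]
  exact E.injective

theorem zipTensor_map_map {M' N' : Type*} [AddCommGroup M'] [Module R M'] [AddCommGroup N']
    [Module R N'] (A : M →ₗ[R] M') (B : N →ₗ[R] N')
    (ξ : (⨂[R] _ : ι, M) ⊗[R] (⨂[R] _ : ι, N)) :
    zipTensor R ι M' N'
        (TensorProduct.map (PiTensorProduct.map fun _ => A) (PiTensorProduct.map fun _ => B) ξ) =
      PiTensorProduct.map (fun _ => TensorProduct.map A B) (zipTensor R ι M N ξ) := by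
  suffices zipTensor R ι M' N' ∘ₗ
        TensorProduct.map (PiTensorProduct.map fun _ => A) (PiTensorProduct.map fun _ => B) =
      PiTensorProduct.map (fun _ => TensorProduct.map A B) ∘ₗ zipTensor R ι M N from
    LinearMap.congr_fun this ξ
  ext x y
  simp [PiTensorProduct.map_tprod]

variable [Fintype ι] [DecidableEq ι]

variable (R ι) in
/-- The tensor power `(u ⊗ v - v ⊗ u)^{⊗ι}`, expanded and regrouped into `M^{⊗ι} ⊗ M^{⊗ι}`; the
set `S` indexes the factors from which `u ⊗ v` is taken. -/
def wedgePower (u v : M) : (⨂[R] _ : ι, M) ⊗[R] (⨂[R] _ : ι, M) :=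
  ∑ S : Finset ι, (-1 : R) ^ Sᶜ.card •
    (PiTensorProduct.tprod R (S.piecewise (fun _ => u) fun _ => v) ⊗ₜ[R]
      PiTensorProduct.tprod R (Sᶜ.piecewise (fun _ => u) fun _ => v))

theorem tprod_piecewise_neg (S : Finset ι) (a b : M) :
    PiTensorProduct.tprod R (S.piecewise (fun _ => a) fun _ => -b) =
      (-1 : R) ^ Sᶜ.card • PiTensorProduct.tprod R (S.piecewise (fun _ => a) fun _ => b) := by
  have pull := (PiTensorProduct.tprod R).map_piecewise_smul (fun _ => (-1 : R))
    (S.piecewise (fun _ => a) fun _ => b) Sᶜ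
  rw [Finset.prod_const] at pull
  rw [← pull]
  congr 1
  ext i
  by_cases hi : i ∈ S <;> simp [hi]

theorem zipTensor_wedgePower (u v : M) :
    zipTensor R ι M M (wedgePower R ι u v) =
      PiTensorProduct.tprod R fun _ => u ⊗ₜ[R] v - v ⊗ₜ[R] u := by
  have zip_piecewise (S : Finset ι) :
      (fun i => S.piecewise (fun _ => u) (fun _ => v) i ⊗ₜ[R]
        Sᶜ.piecewise (fun _ => u) (fun _ => v) i) =
      S.piecewise (fun _ => u ⊗ₜ[R] v) fun _ => v ⊗ₜ[R] u := by
    ext i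
    by_cases hi : i ∈ S <;> simp [hi]
  simp only [wedgePower, map_sum, map_smul, zipTensor_tprod_tmul_tprod, zip_piecewise,
    ← tprod_piecewise_neg, sub_eq_add_neg]
  exact ((PiTensorProduct.tprod R).map_add_univ _ _).symm

theorem map_map_wedgePower [Module.Free R M] {A : M →ₗ[R] M} {u v : M}
    (hA : TensorProduct.map A A (u ⊗ₜ v - v ⊗ₜ u) = u ⊗ₜ[R] v - v ⊗ₜ[R] u) :
    TensorProduct.map (PiTensorProduct.map fun _ => A) (PiTensorProduct.map fun _ => A)
      (wedgePower R ι u v) = wedgePower R ι u v :=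
  zipTensor_injective <| by
    rw [zipTensor_map_map, zipTensor_wedgePower, PiTensorProduct.map_tprod, hA]

end WedgePower

section SymmetricProjection

variable {n : ℕ}

theorem coords_permute (σ : Equiv.Perm (Fin n)) (ξ : TensorPow n) (p : Fin n → Fin 2) :
    coords n (permute σ ξ) p = coords n ξ (p ∘ σ) := by
  let coord (q : Fin n → Fin 2) : TensorPow n →ₗ[ℂ] ℂ :=
    (EuclideanSpace.proj q).toLinearMap ∘ₗ (coords n).toLinearMap
  suffices coord p ∘ₗ permute σ = coord (p ∘ σ) from LinearMap.congr_fun this ξ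
  refine hom_ext fun x => ?_
  change coords n (permute σ (elem x)) p = coords n (elem x) (p ∘ σ)
  rw [permute_elem, coords_elem, coords_elem, ← Equiv.prod_comp σ]
  simp

theorem inner_permute (σ : Equiv.Perm (Fin n)) (ξ η : TensorPow n) :
    inner ℂ (permute σ ξ) (permute σ η) = inner ℂ ξ η := by
  change inner ℂ (coords n (permute σ ξ)) (coords n (permute σ η)) =
    inner ℂ (coords n ξ) (coords n η)
  simp only [PiLp.inner_apply, coords_permute]
  exact (σ.symm.arrowCongr (Equiv.refl (Fin 2))).sum_comp
    fun p => inner ℂ (coords n ξ p) (coords n η p)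

/-- The orthogonal projection onto the symmetric tensors, as a linear map. -/
def symProj (n : ℕ) : TensorPow n →ₗ[ℂ] L n :=
  (symmetricTensors n).orthogonalProjectionOnto.toLinearMap

theorem inner_symProj (w : L n) (ξ : TensorPow n) :
    inner ℂ w (symProj n ξ) = inner ℂ (w : TensorPow n) ξ :=
  Submodule.inner_orthogonalProjectionOnto_eq_of_mem_left w ξ

theorem symProj_permute (σ : Equiv.Perm (Fin n)) (ξ : TensorPow n) :
    symProj n (permute σ ξ) = symProj n ξ :=
  ext_inner_left ℂ fun w => calc
    inner ℂ w (symProj n (permute σ ξ)) = inner ℂ (permute σ w) (permute σ ξ) := by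
      rw [inner_symProj, w.2 σ]
    _ = inner ℂ w (symProj n ξ) := by rw [inner_permute, inner_symProj]

/-- The representation of `SU(2)` on `(ℂ²)^{⊗ n}`. -/
def tensorRep (n : ℕ) : Representation ℂ SU2 (TensorPow n) where
  toFun := tensorFund n
  map_one' := tensorFund_one n
  map_mul' := tensorFund_mul n

theorem symProj_isIntertwiningMap (n : ℕ) :
    (tensorRep n).IsIntertwiningMap (toRep (rho n)) (symProj n) where
  isIntertwining g ξ := ext_inner_left ℂ fun w => by
    obtain ⟨w, rfl⟩ := (rho n g).surjective w
    calc inner ℂ (rho n g w) (symProj n (tensorFund n g ξ))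
        = inner ℂ (tensorFund n g w) (tensorFund n g ξ) := inner_symProj _ _
      _ = inner ℂ (rho n g w) (rho n g (symProj n ξ)) := by
        rw [inner_tensorFund, LinearIsometryEquiv.inner_map_map, inner_symProj]

end SymmetricProjection

section InvariantVector

variable {n : ℕ}

/-- The vector of the product basis of `(ℂ²)^{⊗ n}` with factor `f₀` at the places in `S` and `f₁`
elsewhere. -/
def basisTensor (S : Finset (Fin n)) : TensorPow n :=
  elem (S.piecewise (fun _ => f 0) fun _ => f 1)

theorem permute_basisTensor (σ : Equiv.Perm (Fin n)) (S : Finset (Fin n)) :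
    permute σ (basisTensor S) = basisTensor (S.map σ.toEmbedding) := by
  rw [basisTensor, permute_elem, basisTensor]
  congr 1
  ext1 i
  simp [Finset.piecewise]

theorem inner_f (i j : Fin 2) : inner ℂ (f i) (f j) = if i = j then 1 else 0 :=
  orthonormal_iff_ite.1 (EuclideanSpace.orthonormal_single (𝕜 := ℂ)) i j

theorem inner_basisTensor (S T : Finset (Fin n)) :
    inner ℂ (basisTensor S) (basisTensor T) = if S = T then 1 else 0 := by
  have factor (i : Fin n) : inner ℂ (S.piecewise (fun _ => f 0) (fun _ => f 1) i)
      (T.piecewise (fun _ => f 0) (fun _ => f 1) i) = if i ∈ S ↔ i ∈ T then (1 : ℂ) else 0 := by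
    by_cases hS : i ∈ S <;> by_cases hT : i ∈ T <;>
      simp [-inner_self_eq_norm_sq_to_K, hS, hT, inner_f]
  simp only [basisTensor, inner_elem, factor, Finset.prod_boole, Finset.ext_iff, Finset.mem_univ,
    true_imp_iff]

theorem basisTensor_univ_mem_symmetricTensors :
    basisTensor Finset.univ ∈ symmetricTensors n := fun σ => by
  rw [permute_basisTensor, Finset.map_univ_equiv]

theorem basisTensor_empty_mem_symmetricTensors :
    basisTensor ∅ ∈ symmetricTensors n := fun σ => by
  rw [permute_basisTensor, Finset.map_empty]

theorem symProj_basisTensor (S : Finset (Fin n)) :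
    symProj n (basisTensor S) = monomialVec n S.card := by
  let initial : Finset (Fin n) := Finset.univ.filter fun i => (i : ℕ) < S.card
  have card_initial : S.card = initial.card := by
    rw [Fin.card_filter_val_lt, min_eq_right (card_finset_fin_le S)]
  obtain ⟨σ, hσ⟩ := Equiv.Perm.exists_map_finset_eq S initial card_initial
  have monomialVec_eq : monomialVec n S.card = symProj n (basisTensor initial) := by
    refine congrArg (fun x => symProj n (elem x)) (funext fun i => ?_)
    by_cases hi : (i : ℕ) < S.card <;> simp [initial, hi]
  rw [monomialVec_eq, ← hσ, ← permute_basisTensor, symProj_permute]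

/-- The invariant tensor `(f₀ ⊗ f₁ - f₁ ⊗ f₀)^{⊗ n}`, regrouped into `(ℂ²)^{⊗ n} ⊗ (ℂ²)^{⊗ n}`. -/
def omega (n : ℕ) : TensorPow n ⊗[ℂ] TensorPow n :=
  wedgePower ℂ (Fin n) (f 0) (f 1)

theorem omega_eq_sum (n : ℕ) : omega n =
    ∑ S : Finset (Fin n), (-1 : ℂ) ^ Sᶜ.card • (basisTensor S ⊗ₜ[ℂ] basisTensor Sᶜ) :=
  rfl

theorem map_fund_wedge (g : SU2) : TensorProduct.map (fund g) (fund g)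
    (f 0 ⊗ₜ f 1 - f 1 ⊗ₜ f 0) = f 0 ⊗ₜ[ℂ] f 1 - f 1 ⊗ₜ[ℂ] f 0 := by
  obtain ⟨A, hA⟩ := g
  have hdet : A.det = 1 := (Matrix.mem_specialUnitaryGroup_iff.1 hA).2
  rw [Matrix.det_fin_two] at hdet
  have fund_f (j : Fin 2) : fund ⟨A, hA⟩ (f j) = A 0 j • f 0 + A 1 j • f 1 := by
    ext k
    fin_cases k <;> simp [fund, f, Matrix.toLpLin_apply]
  calc _ = (A 0 0 * A 1 1 - A 0 1 * A 1 0) • (f 0 ⊗ₜ[ℂ] f 1 - f 1 ⊗ₜ[ℂ] f 0) := by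
        simp only [map_sub, TensorProduct.map_tmul, fund_f, TensorProduct.add_tmul,
          TensorProduct.tmul_add, TensorProduct.smul_tmul_smul]
        module
    _ = _ := by rw [hdet, one_smul]

theorem omega_mem_invariants (n : ℕ) : omega n ∈ ((tensorRep n).tprod (tensorRep n)).invariants :=
  fun g => map_map_wedgePower (map_fund_wedge g)

theorem e_tmul_e {k : ℕ} (hk : k ≤ n) :
    e n k ⊗ₜ[ℂ] e n (n - k) = n.choose k • (monomialVec n k ⊗ₜ[ℂ] monomialVec n (n - k)) := by
  rw [e, e, TensorProduct.smul_tmul_smul, Nat.sub_sub_self hk,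
    mul_comm ((n - k).factorial : ℝ), ← Complex.ofReal_mul, Real.mul_self_sqrt (by positivity),
    ← Nat.cast_smul_eq_nsmul ℂ, Nat.cast_choose ℂ hk]
  push_cast
  rfl

theorem map_symProj_omega (n : ℕ) : TensorProduct.map (symProj n) (symProj n) (omega n) =
    ∑ k ∈ Finset.range (n + 1), (-1 : ℂ) ^ (n - k) • (e n k ⊗ₜ[ℂ] e n (n - k)) := by
  let F (k : ℕ) : L n ⊗[ℂ] L n :=
    (-1 : ℂ) ^ (n - k) • (monomialVec n k ⊗ₜ[ℂ] monomialVec n (n - k))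
  calc TensorProduct.map (symProj n) (symProj n) (omega n)
      = ∑ S ∈ (Finset.univ : Finset (Fin n)).powerset, F S.card := by
        simp [omega_eq_sum, symProj_basisTensor, Finset.card_compl, F]
    _ = ∑ k ∈ Finset.range (n + 1), n.choose k • F k := by
        rw [Finset.sum_powerset_apply_card, Finset.card_fin]
    _ = _ := Finset.sum_congr rfl fun k hk => by
        rw [e_tmul_e (Finset.mem_range_succ_iff.1 hk), smul_comm]

theorem delta_mem_determinant (n : ℕ) : delta n ∈ determinant (rho n) := by
  rw [determinant_eq_invariants, delta, ← map_symProj_omega]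
  exact Submodule.smul_mem _ _
    (map_mem_invariants_tprod (symProj_isIntertwiningMap n) (omega_mem_invariants n))

theorem map_symProj_omega_ne_zero (n : ℕ) :
    TensorProduct.map (symProj n) (symProj n) (omega n) ≠ 0 := by
  let a : L n := ⟨basisTensor Finset.univ, basisTensor_univ_mem_symmetricTensors⟩
  let b : L n := ⟨basisTensor ∅, basisTensor_empty_mem_symmetricTensors⟩
  let l : Module.Dual ℂ (L n ⊗[ℂ] L n) :=
    TensorProduct.dualDistrib ℂ (L n) (L n) (innerₛₗ ℂ a ⊗ₜ innerₛₗ ℂ b)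
  have inner_a (S : Finset (Fin n)) :
      inner ℂ a (symProj n (basisTensor S)) = if Finset.univ = S then 1 else 0 :=
    (inner_symProj a _).trans (inner_basisTensor _ S)
  have inner_b : inner ℂ b (symProj n (basisTensor ∅)) = 1 := by
    rw [inner_symProj, inner_basisTensor, if_pos rfl]
  have l_eq_one : l (TensorProduct.map (symProj n) (symProj n) (omega n)) = 1 := by
    simp [-Submodule.coe_inner, l, omega_eq_sum, inner_a, inner_b]
  intro h
  simp [h] at l_eq_one

theorem delta_ne_zero (n : ℕ) : delta n ≠ 0 := by
  have : (√((n : ℝ) + 1))⁻¹ ≠ 0 := by positivity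
  rw [delta, ← map_symProj_omega]
  exact smul_ne_zero (Complex.ofReal_ne_zero.2 this) (map_symProj_omega_ne_zero n)

end InvariantVector

end SUTwo

end

theorem propositionp {H : Type*} [NormedAddCommGroup H] [InnerProductSpace ℂ H]
    [FiniteDimensional ℂ H] (n : ℕ) (hdim : Module.finrank ℂ H = n + 1)
    (τ : SUTwo.SU2 →* (H ≃ₗᵢ[ℂ] H)) (hcont : SUTwo.IsStronglyContinuous τ)
    (hirr : SUTwo.IsIrreducible τ) :
    Module.finrank ℂ (SUTwo.determinant τ) = 1 ∧
      ∀ V : SUTwo.L n ≃ₗᵢ[ℂ] H, SUTwo.Intertwines V τ →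
        SUTwo.determinant τ =
          Submodule.span ℂ {TensorProduct.map V.toLinearEquiv.toLinearMap
            V.toLinearEquiv.toLinearMap (SUTwo.delta n)} := by
  have finrank_eq_one := SUTwo.finrank_determinant hcont hirr
  refine ⟨finrank_eq_one, fun V hV => ?_⟩
  let v := TensorProduct.map V.toLinearEquiv.toLinearMap V.toLinearEquiv.toLinearMap (SUTwo.delta n)
  have hmem : v ∈ SUTwo.determinant τ :=
    SUTwo.map_mem_invariants_tprod hV.isIntertwiningMap (SUTwo.delta_mem_determinant n)
  have hne : v ≠ 0 :=
    (TensorProduct.congr V.toLinearEquiv V.toLinearEquiv).map_ne_zero_iff.2 (SUTwo.delta_ne_zero n)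
  symm
  exact Submodule.eq_of_le_of_finrank_eq ((Submodule.span_singleton_le_iff_mem _ _).2 hmem)
    ((finrank_span_singleton hne).trans finrank_eq_one.symm)
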